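/- **Definitions.** Let $\mathcal V$ be a real Banach space and let $\mathcal K\subseteq\mathcal V$ be $\sigma$-convex: whenever $\lambda_i\ge 0$, $\sum_{i=1}^\infty\lambda_i=1$ and $v_i\in\mathcal K$, the series $\sum\lambda_i v_i$ converges in norm to an element of $\mathcal K$ (such a $\mathcal K$ is called a probabilistic theory, its elements states). Let $\mathcal M(\mathbb R^n)$ be the set of Borel probability measures on $\mathbb R^n$. An $n$-dimensional observable on $\mathcal K$ is a $\sigma$-affine map $M:\mathcal K\to\mathcal M(\mathbb R^n)$, i.e. $M(\sum\lambda_i v_i)(A)=\sum\lambda_i M(v_i)(A)$ for all such $\lambda_i,v_i$ and all Borel sets $A$; $\mathcal O_n(\mathcal K)$ is the set of these and $\mathcal O(\mathcal K)=\mathcal O_1(\mathcal K)$. Observables $M_1,\dots,M_n\in\mathcal O(\mathcal K)$ are compatible if there is a joint observable $\widetilde M\in\mathcal O_n(\mathcal K)$, that is, $\widetilde M(s)(\{x: x_i\in A\})=M_i(s)(A)$ for all $i$, all $s\in\mathcal K$ and all Borel $A\subseteq\mathbb R$. For $p\in\mathcal M(\mathbb R)$ let $T_p(s)=p$ for every $s$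 (a trivial observable). For $M,N\in\mathcal O(\mathcal K)$ let - $J(M,N)$ be the set of $(\lambda,\mu)\in[0,1]^2$ such that, for some $p,q\in\mathcal M(\mathbb R)$, $\lambda M+(1-\lambda)T_p$ and $\mu N+(1-\mu)T_q$ are compatible, and $J(\mathcal K)=\bigcap_{M,N\in\mathcal O(\mathcal K)}J(M,N)$; - $I(M,N)$ be the set of $\lambda\in[0,1]$ such that, for some $p\in\mathcal M(\mathbb R)$, $M$ and $\lambda N+(1-\lambda)T_p$ are compatible, and $I(\mathcal K)=\bigcap_{M,N\in\mathcal O(\mathcal K)}I(M,N)$. The index of compatibility of $\mathcal K$ is $\lambda(\mathcal K)=\inf_{M,N\in\mathcal O(\mathcal K)}\sup I(M,N)$. **Statement.** Let $(\Omega,\mathcal A)$ be a measurable space, $\mathcal V$ the Banach space of real-valued measures on $\mathcal A$ with the total variation norm, and $\mathcal K\subseteq\mathcal V$ the set of probability measures on $\mathcal A$. Then: 1. $\mathcal K$ is $\sigma$-convex, and the closed linear hull of $\mathcal K$ is $\mathcal V$. 2. For measurable $f,g:\Omega\to\mathbb R$, let $M_f,M_g\in\mathcal O(\mathcal K)$ be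 the sharp observables $M_f(s)(A)=s(f^{-1}(A))$, $M_g(s)(A)=s(g^{-1}(A))$. There is a unique $\widetilde M\in\mathcal O_2(\mathcal K)$ with $\widetilde M(s)(A\times B)=s(f^{-1}(A)\cap g^{-1}(B))$ for all $s\in\mathcal K$ and all Borel $A,B\subseteq\mathbb R$, and it is a joint observable for $M_f,M_g$. 3. Let $\widehat M,\widehat N$ be maps from the Borel sets of $\mathbb R$ to the measurable functions $\Omega\to[0,1]$ which are pointwise $\sigma$-additive and satisfy $\widehat M(\mathbb R)=\widehat N(\mathbb R)=1$, and let $M(s)(A)=\int\widehat M(A)\,ds$, $N(s)(A)=\int\widehat N(A)\,ds$ be the corresponding fuzzy observables. There is a joint observable $\widetilde M\in\mathcal O_2(\mathcal K)$ for $M,N$ with $\widetilde M(s)(A\times B)=\int\widehat M(A)\widehat N(B)\,ds$ for all $s\in\mathcal K$ and all Borel $A,B\subseteq\mathbb R$. 4. Any two observables $M,N\in\mathcal O(\mathcal K)$ (sharp, fuzzy or other) are compatible. 5. $J(\mathcal K)=[0,1]\times[0,1]$, $I(\mathcal K)=[0,1]$ and $\lambda(\mathcal K)=1$. -/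

import Mathlib

open MeasureTheory

/-! ### Probabilistic theories and observables -/

section General

variable {V : Type*} [NormedAddCommGroup V] [NormedSpace ℝ V]

/-- A probabilistic theory: a σ-convex subset `K` (the set of states) of a real Banach space. -/
structure IsProbabilisticTheory [CompleteSpace V] (K : Set V) : Prop where
  sigmaConvex : ∀ (w : ℕ → ℝ) (v : ℕ → V), (∀ i, 0 ≤ w i) → HasSum w 1 → (∀ i, v i ∈ K) →
    ∃ s ∈ K, HasSum (fun i => w i • v i) s

/-- `K` generates `V`: the closed linear hull of `K` is all of `V`. -/
def Generates (K : Set V) : Prop :=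
  (Submodule.span ℝ K).topologicalClosure = ⊤

/-- Observables on `K` with value space `X`: the σ-affine maps from `K` to the probability
measures on `X`. -/
structure Observable (K : Set V) (X : Type*) [MeasurableSpace X] where
  toFun : K → ProbabilityMeasure X
  sigmaAffine : ∀ (w : ℕ → ℝ) (v : ℕ → K) (s : K), (∀ i, 0 ≤ w i) → HasSum w 1 →
    HasSum (fun i => w i • (v i : V)) (s : V) →
    ∀ A : Set X, MeasurableSet A →
      HasSum (fun i => w i * (toFun (v i) : Measure X).real A) ((toFun s : Measure X).real A)

/-- The probability `M(s)(A)` that `M` has a value in `A` when the system is in the state `s`. -/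
noncomputable def Observable.prob {K : Set V} {X : Type*} [MeasurableSpace X]
    (M : Observable K X) (s : K) (A : Set X) : ℝ :=
  (M.toFun s : Measure X).real A

/-- The `n`-dimensional observable `J` has the marginals `M 0, …, M (n - 1)`. -/
def IsJointObservable {K : Set V} {n : ℕ} (J : Observable K (Fin n → ℝ))
    (M : Fin n → Observable K ℝ) : Prop :=
  ∀ (i : Fin n) (s : K) (A : Set ℝ), MeasurableSet A → J.prob s {x | x i ∈ A} = (M i).prob s A

/-- Compatibility (joint measurability) of finitely many observables. -/
def Compatible {K : Set V} {n : ℕ} (M : Fin n → Observable K ℝ) : Prop :=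
  ∃ J : Observable K (Fin n → ℝ), IsJointObservable J M

/-- The trivial observable `T_p`. -/
def trivialObservable (K : Set V) (p : ProbabilityMeasure ℝ) : Observable K ℝ where
  toFun _ := p
  sigmaAffine w _ _ _ hw _ A _ := by
    simpa using hw.mul_right ((p : Measure ℝ).real A)

/-- The convex combination `l • μ + (1 - l) • ν` of probability measures. -/
noncomputable def mixMeasure {X : Type*} [MeasurableSpace X] (l : unitInterval)
    (μ ν : ProbabilityMeasure X) : ProbabilityMeasure X :=
  ⟨ENNReal.ofReal (l : ℝ) • (μ : Measure X) + ENNReal.ofReal (1 - (l : ℝ)) • (ν : Measure X), ⟨by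
    simp only [Measure.add_apply, Measure.smul_apply, measure_univ, smul_eq_mul, mul_one]
    rw [← ENNReal.ofReal_add l.2.1 (by linarith [l.2.2])]
    simp⟩⟩

theorem mixMeasure_real {X : Type*} [MeasurableSpace X] (l : unitInterval)
    (μ ν : ProbabilityMeasure X) (A : Set X) :
    (mixMeasure l μ ν : Measure X).real A =
      (l : ℝ) * (μ : Measure X).real A + (1 - (l : ℝ)) * (ν : Measure X).real A := by
  have h1 : (0 : ℝ) ≤ 1 - (l : ℝ) := by linarith [l.2.2]
  simp only [mixMeasure, ProbabilityMeasure.coe_mk, Measure.real, Measure.add_apply,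
    Measure.smul_apply, smul_eq_mul]
  rw [ENNReal.toReal_add (ENNReal.mul_ne_top ENNReal.ofReal_ne_top (measure_ne_top _ _))
    (ENNReal.mul_ne_top ENNReal.ofReal_ne_top (measure_ne_top _ _))]
  simp [ENNReal.toReal_mul, ENNReal.toReal_ofReal l.2.1, ENNReal.toReal_ofReal h1]

/-- The convex combination `l M + (1 - l) N` of observables. -/
noncomputable def Observable.mix {K : Set V} (l : unitInterval) (M N : Observable K ℝ) :
    Observable K ℝ where
  toFun s := mixMeasure l (M.toFun s) (N.toFun s)
  sigmaAffine w v s h0 h1 hs A hA := by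
    simp only [mixMeasure_real]
    refine (((M.sigmaAffine w v s h0 h1 hs A hA).mul_left (l : ℝ)).add
      ((N.sigmaAffine w v s h0 h1 hs A hA).mul_left (1 - (l : ℝ)))).congr_fun fun i => ?_
    ring

/-- The compatibility region `J(M 0, …, M (n - 1))`, a subset of `[0,1]^n`. -/
def compatibilityRegion {K : Set V} {n : ℕ} (M : Fin n → Observable K ℝ) : Set (Fin n → ℝ) :=
  {c | ∃ l : Fin n → unitInterval, (∀ i, c i = (l i : ℝ)) ∧
    ∃ p : Fin n → ProbabilityMeasure ℝ,
      Compatible fun i => (M i).mix (l i) (trivialObservable K (p i))}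

/-- The `n`-dimensional compatibility region `J_n(K)` of a probabilistic theory. -/
def compatibilityRegionOf (n : ℕ) (K : Set V) : Set (Fin n → ℝ) :=
  ⋂ M : Fin n → Observable K ℝ, compatibilityRegion M

/-- The compatibility interval `I(M, N)`, a subset of `[0,1]`. -/
def compatibilityInterval {K : Set V} (M N : Observable K ℝ) : Set ℝ :=
  {c | ∃ l : unitInterval, c = (l : ℝ) ∧
    ∃ p : ProbabilityMeasure ℝ, Compatible ![M, N.mix l (trivialObservable K p)]}

/-- The interval of compatibility `I(K)` of a probabilistic theory. -/
def compatibilityIntervalOf (K : Set V) : Set ℝ :=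
  ⋂ (M : Observable K ℝ) (N : Observable K ℝ), compatibilityInterval M N

/-- The index of compatibility of two observables. -/
noncomputable def compatibilityIndex {K : Set V} (M N : Observable K ℝ) : ℝ :=
  sSup (compatibilityInterval M N)

/-- The index of compatibility of a probabilistic theory. -/
noncomputable def compatibilityIndexOf (K : Set V) : ℝ :=
  sInf {r | ∃ M N : Observable K ℝ, r = compatibilityIndex M N}

end General

/-! ### The Banach space of real-valued measures with the total variation norm -/

section Classical

variable {Ω : Type*} [MeasurableSpace Ω]

instance signedMeasureVariationFinite (v : SignedMeasure Ω) : IsFiniteMeasure v.variation := by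
  rw [← SignedMeasure.totalVariation_eq_variation]; infer_instance

/-- The norm of a real-valued measure is its total variation. -/
noncomputable instance signedMeasureNormedAddCommGroup :
    NormedAddCommGroup (SignedMeasure Ω) :=
  AddGroupNorm.toNormedAddCommGroup
    { toFun := fun v => v.totalVariation.real Set.univ
      map_zero' := by simp [SignedMeasure.totalVariation_zero]
      add_le' := fun v w => by
        simp only [SignedMeasure.totalVariation_eq_variation]
        rw [← measureReal_add_apply]
        exact ENNReal.toReal_mono (measure_ne_top _ _)
          (VectorMeasure.variation_add_le (μ := v) (ν := w) Set.univ)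
      neg' := fun v => by simp [SignedMeasure.totalVariation_neg]
      eq_zero_of_map_eq_zero' := fun v hv => by
        ext A _
        have h := SignedMeasure.norm_le_totalVariation v A
        have h2 : v.totalVariation.real A ≤ v.totalVariation.real Set.univ :=
          measureReal_mono (Set.subset_univ _)
        have h3 : ‖v A‖ ≤ 0 := h.trans (h2.trans hv.le)
        simpa using h3 }

theorem signedMeasure_norm_def (v : SignedMeasure Ω) :
    ‖v‖ = v.totalVariation.real Set.univ := rfl

theorem signedMeasure_norm_apply_le (v : SignedMeasure Ω) (A : Set Ω) : ‖v A‖ ≤ ‖v‖ :=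
  (SignedMeasure.norm_le_totalVariation v A).trans (measureReal_mono (Set.subset_univ _))

noncomputable instance signedMeasureNormedSpace : NormedSpace ℝ (SignedMeasure Ω) where
  norm_smul_le c v := by
    simp only [signedMeasure_norm_def, SignedMeasure.totalVariation_eq_variation]
    rw [VectorMeasure.variation_smul]
    simp [Measure.real]

/-- Evaluation at a set is continuous for the total variation norm. -/
theorem signedMeasure_hasSum_apply {u : ℕ → SignedMeasure Ω} {v : SignedMeasure Ω}
    (h : HasSum u v) (A : Set Ω) : HasSum (fun i => u i A) (v A) := by
  let e : SignedMeasure Ω →+ ℝ :=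
    { toFun := fun v => v A, map_zero' := rfl, map_add' := fun _ _ => rfl }
  have he : Continuous e := AddMonoidHomClass.continuous_of_bound e 1 fun v => by
    rw [one_mul]
    exact signedMeasure_norm_apply_le v A
  exact h.map e he

/-- The real-valued measures form a Banach space: absolutely convergent series converge. -/
instance signedMeasureCompleteSpace : CompleteSpace (SignedMeasure Ω) := by
  apply NormedAddCommGroup.completeSpace_of_summable_imp_tendsto
  intro u hu
  have habs : ∀ A, Summable fun n => ‖u n A‖ := fun A =>
    hu.of_nonneg_of_le (fun _ => norm_nonneg _) fun n => signedMeasure_norm_apply_le (u n) A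
  have hfin : ∑' n, (u n).variation Set.univ ≠ ⊤ := by
    have h : ∀ n, (u n).variation Set.univ = ENNReal.ofReal ‖u n‖ := fun n => by
      rw [signedMeasure_norm_def, SignedMeasure.totalVariation_eq_variation]
      simp [Measure.real]
    simp_rw [h]
    exact hu.tsum_ofReal_ne_top
  let v : SignedMeasure Ω :=
    { measureOf' := fun A => ∑' n, u n A
      empty' := by simp
      not_measurable' := fun A hA => by simp [VectorMeasure.not_measurable _ hA]
      m_iUnion' := fun A hA hd => by
        have hsum : Summable fun p : ℕ × ℕ => u p.1 (A p.2) := by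
          apply Summable.of_norm
          rw [summable_prod_of_nonneg (fun _ => norm_nonneg _)]
          have hle : ∀ n (t : Finset ℕ), ∑ i ∈ t, ‖u n (A i)‖ ≤ ‖u n‖ := fun n t => by
            calc ∑ i ∈ t, ‖u n (A i)‖
                ≤ ∑ i ∈ t, (u n).totalVariation.real (A i) :=
                  Finset.sum_le_sum fun i _ => SignedMeasure.norm_le_totalVariation _ _
              _ = (u n).totalVariation.real (⋃ i ∈ t, A i) :=
                  (measureReal_biUnion_finset (fun i _ j _ hij => hd hij) fun i _ => hA i).symm
              _ ≤ ‖u n‖ := measureReal_mono (Set.subset_univ _)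
          have hs : ∀ n, Summable fun i => ‖u n (A i)‖ := fun n =>
            summable_of_sum_le (fun _ => norm_nonneg _) (hle n)
          exact ⟨hs, hu.of_nonneg_of_le (fun n => tsum_nonneg fun _ => norm_nonneg _)
            fun n => (hs n).tsum_le_of_sum_le (hle n)⟩
        have h1 : ∀ n, HasSum (fun i => u n (A i)) (u n (⋃ i, A i)) := fun n =>
          (u n).m_iUnion hA hd
        have h2 := hsum.prod_symm.hasSum.prod_fiberwise
          (fun i => (habs (A i)).of_norm.hasSum)
        have h3 := hsum.hasSum.prod_fiberwise h1
        have h4 : ∑' p : ℕ × ℕ, u p.swap.1 (A p.swap.2) = ∑' p : ℕ × ℕ, u p.1 (A p.2) :=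
          (Equiv.prodComm ℕ ℕ).tsum_eq fun p : ℕ × ℕ => u p.1 (A p.2)
        rw [h3.tsum_eq, ← h4]
        exact h2 }
  have hv : ∀ A, v A = ∑' n, u n A := fun _ => rfl
  have heval : ∀ k A, (∑ n ∈ Finset.range k, u n) A = ∑ n ∈ Finset.range k, u n A := fun k A => by
    let e : SignedMeasure Ω →+ ℝ :=
      { toFun := fun v => v A, map_zero' := rfl, map_add' := fun _ _ => rfl }
    exact map_sum e u (Finset.range k)
  refine ⟨v, ?_⟩
  rw [tendsto_iff_norm_sub_tendsto_zero]
  have hb : ∀ k, ‖∑ n ∈ Finset.range k, u n - v‖ ≤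
      (∑' n, (u (n + k)).variation Set.univ).toReal := fun k => by
    have hfin' : ∑' n, (u (n + k)).variation Set.univ ≠ ⊤ :=
      ne_top_of_le_ne_top hfin
        (ENNReal.tsum_comp_le_tsum_of_injective (add_left_injective k)
          fun n => (u n).variation Set.univ)
    rw [signedMeasure_norm_def, SignedMeasure.totalVariation_eq_variation]
    have hm : (∑ n ∈ Finset.range k, u n - v).variation ≤
        Measure.sum fun n => (u (n + k)).variation := by
      apply VectorMeasure.variation_le_of_forall_enorm_le
      intro A hA
      rw [Measure.sum_apply _ hA]
      have hEq : (∑ n ∈ Finset.range k, u n - v) A = -∑' n, u (n + k) A := by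
        change (∑ n ∈ Finset.range k, u n) A - v A = _
        rw [heval, hv, ← (habs A).of_norm.sum_add_tsum_nat_add k]
        ring
      rw [hEq, enorm_neg]
      refine (enorm_tsum_le_tsum_enorm).trans (ENNReal.tsum_le_tsum fun n => ?_)
      exact VectorMeasure.enorm_measure_le_variation _ _
    have h := hm Set.univ
    rw [Measure.sum_apply _ MeasurableSet.univ] at h
    exact ENNReal.toReal_mono hfin' h
  refine squeeze_zero (fun _ => norm_nonneg _) hb ?_
  have ht := ENNReal.tendsto_sum_nat_add (fun n => (u n).variation Set.univ) hfin
  exact (ENNReal.tendsto_toReal ENNReal.zero_ne_top).comp ht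

/-! ### Classical probability theory -/

/-- The states of classical probability theory: the probability measures on `Ω`, seen in the
Banach space of real-valued measures. -/
def classicalStates (Ω : Type*) [MeasurableSpace Ω] : Set (SignedMeasure Ω) :=
  Set.range fun P : ProbabilityMeasure Ω => (P : Measure Ω).toSignedMeasure

/-- A classical state as a probability measure. -/
noncomputable def stateMeasure (s : classicalStates Ω) : ProbabilityMeasure Ω :=
  Classical.choose s.2

theorem stateMeasure_toSignedMeasure (s : classicalStates Ω) :
    (stateMeasure s : Measure Ω).toSignedMeasure = (s : SignedMeasure Ω) :=
  Classical.choose_spec s.2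

theorem stateMeasure_eq_sum {w : ℕ → ℝ} {v : ℕ → classicalStates Ω} {s : classicalStates Ω}
    (h0 : ∀ i, 0 ≤ w i)
    (hs : HasSum (fun i => w i • (v i : SignedMeasure Ω)) (s : SignedMeasure Ω)) :
    (stateMeasure s : Measure Ω) =
      Measure.sum fun i => ENNReal.ofReal (w i) • (stateMeasure (v i) : Measure Ω) := by
  ext A hA
  have h := signedMeasure_hasSum_apply hs A
  simp only [← stateMeasure_toSignedMeasure] at h
  have h' : HasSum (fun i => w i * (stateMeasure (v i) : Measure Ω).real A)
      ((stateMeasure s : Measure Ω).real A) := by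
    convert h using 1
    · ext i
      change _ = w i * _
      rw [Measure.toSignedMeasure_apply_measurable hA]
    · rw [Measure.toSignedMeasure_apply_measurable hA]
  rw [Measure.sum_apply _ hA, ← ENNReal.ofReal_toReal (measure_ne_top (stateMeasure s : Measure Ω) A)]
  change ENNReal.ofReal ((stateMeasure s : Measure Ω).real A) = _
  rw [← h'.tsum_eq, ENNReal.ofReal_tsum_of_nonneg
    (fun i => mul_nonneg (h0 i) measureReal_nonneg) h'.summable]
  congr 1
  ext i
  rw [ENNReal.ofReal_mul (h0 i)]
  simp [Measure.real]

/-- Integrals of bounded nonnegative functions are σ-affine in the state. -/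
theorem hasSum_lintegral_state {w : ℕ → ℝ} {v : ℕ → classicalStates Ω} {s : classicalStates Ω}
    (h0 : ∀ i, 0 ≤ w i)
    (hs : HasSum (fun i => w i • (v i : SignedMeasure Ω)) (s : SignedMeasure Ω))
    (g : Ω → ENNReal) (hg : ∀ ω, g ω ≤ 1) :
    HasSum (fun i => w i * (∫⁻ ω, g ω ∂(stateMeasure (v i) : Measure Ω)).toReal)
      (∫⁻ ω, g ω ∂(stateMeasure s : Measure Ω)).toReal := by
  have hfin : ∀ t : classicalStates Ω, ∫⁻ ω, g ω ∂(stateMeasure t : Measure Ω) ≠ ⊤ := fun t =>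
    ((lintegral_mono hg).trans_lt (by simp)).ne
  have h : ∫⁻ ω, g ω ∂(stateMeasure s : Measure Ω) =
      ∑' i, ENNReal.ofReal (w i) * ∫⁻ ω, g ω ∂(stateMeasure (v i) : Measure Ω) := by
    rw [stateMeasure_eq_sum h0 hs, lintegral_sum_measure]
    simp
  have h2 := ENNReal.hasSum_toReal (h ▸ hfin s)
  rw [← ENNReal.tsum_toReal_eq
    (fun i => ENNReal.mul_ne_top ENNReal.ofReal_ne_top (hfin _)), ← h] at h2
  simpa [ENNReal.toReal_mul, ENNReal.toReal_ofReal (h0 _)] using h2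

/-- The sharp observable `M_f`, with `M_f(s)(A) = s(f⁻¹(A))`. -/
noncomputable def sharpObservable (f : Ω → ℝ) (hf : Measurable f) :
    Observable (classicalStates Ω) ℝ where
  toFun s := (stateMeasure s).map hf.aemeasurable
  sigmaAffine w v s h0 _ hs A hA := by
    have h := hasSum_lintegral_state h0 hs ((f ⁻¹' A).indicator 1)
      (fun ω => Set.indicator_le_self' (fun _ _ => zero_le) ω)
    simpa [lintegral_indicator_one (hf hA), Measure.real, Measure.map_apply hf hA] using h

/-- A normalized effect-valued measure on the Borel sets of the line: `E A` is a measurable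
function `Ω → [0,1]` for each Borel set `A`, `E ℝ = 1`, and `E` is σ-additive. -/
structure EffectMeasure (Ω : Type*) [MeasurableSpace Ω] where
  toFun : Set ℝ → Ω → ℝ
  measurable : ∀ A, MeasurableSet A → Measurable (toFun A)
  mem_Icc : ∀ A, MeasurableSet A → ∀ ω, toFun A ω ∈ Set.Icc (0 : ℝ) 1
  univ : ∀ ω, toFun Set.univ ω = 1
  iUnion : ∀ A : ℕ → Set ℝ, (∀ i, MeasurableSet (A i)) → Pairwise (Function.onFun Disjoint A) →
    ∀ ω, HasSum (fun i => toFun (A i) ω) (toFun (⋃ i, A i) ω)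

theorem EffectMeasure.empty (E : EffectMeasure Ω) (ω : Ω) : E.toFun ∅ ω = 0 := by
  have h := E.iUnion (fun _ => ∅) (fun _ => MeasurableSet.empty)
    (fun _ _ _ => by simp [Function.onFun]) ω
  simpa using tendsto_nhds_unique tendsto_const_nhds h.summable.tendsto_atTop_zero

/-- The measure `A ↦ ∫ E(A) ds`. -/
noncomputable def fuzzyMeasure (E : EffectMeasure Ω) (s : classicalStates Ω) : Measure ℝ :=
  Measure.ofMeasurable
    (fun A _ => ∫⁻ ω, ENNReal.ofReal (E.toFun A ω) ∂(stateMeasure s : Measure Ω))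
    (by simp [E.empty])
    (fun A hA hd => by
      rw [← lintegral_tsum fun i => (E.measurable _ (hA i)).ennreal_ofReal.aemeasurable]
      congr 1
      ext ω
      have h := E.iUnion A hA hd ω
      rw [← h.tsum_eq, ENNReal.ofReal_tsum_of_nonneg (fun i => (E.mem_Icc _ (hA i) ω).1)
        h.summable])

theorem fuzzyMeasure_apply (E : EffectMeasure Ω) (s : classicalStates Ω) {A : Set ℝ}
    (hA : MeasurableSet A) : fuzzyMeasure E s A =
      ∫⁻ ω, ENNReal.ofReal (E.toFun A ω) ∂(stateMeasure s : Measure Ω) :=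
  Measure.ofMeasurable_apply A hA

/-- The fuzzy (unsharp) observable of an effect-valued measure `E`, with
`M(s)(A) = ∫ E(A) ds`. -/
noncomputable def fuzzyObservable (E : EffectMeasure Ω) :
    Observable (classicalStates Ω) ℝ where
  toFun s := ⟨fuzzyMeasure E s, ⟨by simp [fuzzyMeasure_apply, E.univ]⟩⟩
  sigmaAffine w v s h0 _ hs A hA := by
    simpa [Measure.real, fuzzyMeasure_apply, hA] using
      hasSum_lintegral_state h0 hs (fun ω => ENNReal.ofReal (E.toFun A ω))
        (fun ω => by simpa using (E.mem_Icc A hA ω).2)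

theorem sharpObservable_prob (f : Ω → ℝ) (hf : Measurable f) (s : classicalStates Ω) {A : Set ℝ}
    (hA : MeasurableSet A) :
    (sharpObservable f hf).prob s A = (stateMeasure s : Measure Ω).real (f ⁻¹' A) := by
  simp [Observable.prob, sharpObservable, Measure.real, Measure.map_apply hf hA]

theorem fuzzyObservable_prob (E : EffectMeasure Ω) (s : classicalStates Ω) {A : Set ℝ}
    (hA : MeasurableSet A) :
    (fuzzyObservable E).prob s A = ∫ ω, E.toFun A ω ∂(stateMeasure s : Measure Ω) := by
  rw [integral_eq_lintegral_of_nonneg_ae (.of_forall fun ω => (E.mem_Icc A hA ω).1)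
    (E.measurable A hA).aestronglyMeasurable]
  simp [Observable.prob, fuzzyObservable, Measure.real, fuzzyMeasure_apply, hA]

end Classical

/-! ### Disintegration over an arbitrary measurable space, and its uniqueness. -/

section Disintegration

open ProbabilityTheory Filter Topology

/-! The core is compatibility of arbitrary `M`, `N`. An observable need not come from one
effect-valued function: the total mass of the atoms is σ-affine, yet it is 1 on every Dirac measure
of the line and 0 on Lebesgue measure of `[0,1]`. But below a fixed state `s` it does. Extended
homogeneously to finite measures, `M` is σ-additive (`Observable.extend_sum`), so `C ↦ M(s|_C)`
disintegrates over `s`: Radon–Nikodym densities at rational half-lines form a distribution function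
almost everywhere. This gives a Markov kernel `κ_s` representing `M` on all finite `ρ ≪ s`
(`Observable.exists_kernel`). Only the value space has to be nice, so `Ω` is arbitrary.

The joint observable at `s` averages the product of the two kernels of `s`. This product varies with
`s`, so σ-affinity needs an argument: in a mixture `s = ∑ w_i v_i`, every `v_i` with `w_i > 0`
satisfies `v_i ≪ s`, and almost everywhere uniqueness makes the kernels of `v_i` and `s` agree
`v_i`-a.e. (`Observable.localKernel_ae_eq`). All terms can thus be computed with the kernel of `s`,
where integration is linear.

Sharp and fuzzy observables have global kernels, which makes the same product explicit. σ-convexity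
is absolute convergence in the Banach space, and the Jordan decomposition gives the linear hull. The
regions and the index follow because mixtures with trivial observables are again observables. -/

/-- Disintegration of a bimeasure: a σ-additive family of measures on the line indexed by the
measurable subsets of `Ω`, whose total masses are given by a finite measure `s`, is given by a
Markov kernel. -/
theorem exists_kernel_of_sigmaAdditive {Ω : Type*} [MeasurableSpace Ω] (s : Measure Ω)
    [IsFiniteMeasure s] (ν : Set Ω → Measure ℝ)
    (hmass : ∀ C, MeasurableSet C → ν C Set.univ = s C)
    (hsum : ∀ C : ℕ → Set Ω, (∀ i, MeasurableSet (C i)) → Pairwise (Function.onFun Disjoint C) →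
      ν (⋃ i, C i) = Measure.sum fun i => ν (C i)) :
    ∃ κ : Kernel Ω ℝ, IsMarkovKernel κ ∧
      ∀ C, MeasurableSet C → ν C = (s.restrict C).bind κ := by
  have hfin : ∀ C, MeasurableSet C → IsFiniteMeasure (ν C) := fun C hC =>
    ⟨by rw [hmass C hC]; exact measure_lt_top _ _⟩
  have hempty : ν ∅ = 0 := by
    rw [← Measure.measure_univ_eq_zero, hmass ∅ MeasurableSet.empty, measure_empty]
  -- For fixed `q` the set function in `C` is a measure dominated by `s`; its density `G q` is the
  -- candidate value at `q` of the conditional distribution function.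
  let L : ℚ → Measure Ω := fun q => Measure.ofMeasurable (fun C _ => ν C (Set.Iic (q : ℝ)))
    (by simp [hempty])
    (fun C hC hd => by rw [hsum C hC hd, Measure.sum_apply _ measurableSet_Iic])
  have hL : ∀ q C, MeasurableSet C → L q C = ν C (Set.Iic (q : ℝ)) := fun q C hC =>
    Measure.ofMeasurable_apply C hC
  have hLs : ∀ q, L q ≤ s := fun q => Measure.le_iff.2 fun C hC => by
    rw [hL q C hC, ← hmass C hC]
    exact measure_mono (Set.subset_univ _)
  have hLfin : ∀ q, IsFiniteMeasure (L q) := fun q => isFiniteMeasure_of_le s (hLs q)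
  let G : ℚ → Ω → ENNReal := fun q => (L q).rnDeriv s
  have hGm : ∀ q, Measurable (G q) := fun q => Measure.measurable_rnDeriv _ _
  have hG : ∀ q C, MeasurableSet C → ∫⁻ ω in C, G q ω ∂s = ν C (Set.Iic (q : ℝ)) := fun q C hC => by
    rw [← hL q C hC, ← withDensity_apply _ hC]
    exact congrArg (fun m : Measure Ω => m C) (Measure.withDensity_rnDeriv_eq _ _
      (Measure.absolutelyContinuous_of_le (hLs q)))
  have hGu : ∀ q, ∫⁻ ω, G q ω ∂s = ν Set.univ (Set.Iic (q : ℝ)) := fun q => by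
    rw [← hG q _ MeasurableSet.univ, Measure.restrict_univ]
  have := hfin _ MeasurableSet.univ
  -- Inequalities of integrals over every `C` give inequalities a.e.; rational indices leave only
  -- countably many null sets.
  have hmono : ∀ᵐ ω ∂s, Monotone fun q => G q ω := by
    simp_rw [Monotone, ae_all_iff]
    refine fun r r' hrr' => ae_le_of_forall_setLIntegral_le_of_sigmaFinite (hGm r) fun C hC _ => ?_
    rw [hG r C hC, hG r' C hC]
    exact measure_mono (Set.Iic_subset_Iic.2 (mod_cast hrr'))
  have hle : ∀ᵐ ω ∂s, ∀ q, G q ω ≤ 1 := by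
    rw [ae_all_iff]
    refine fun r => ae_le_of_forall_setLIntegral_le_of_sigmaFinite (hGm r) fun C hC _ => ?_
    rw [hG r C hC, setLIntegral_one, ← hmass C hC]
    exact measure_mono (Set.subset_univ _)
  have htop : ∀ᵐ ω ∂s, Tendsto (fun n : ℕ => G n ω) atTop (𝓝 1) := by
    refine tendsto_of_lintegral_tendsto_of_monotone (F := fun _ => 1) aemeasurable_const ?_ ?_ ?_
      (by simp)
    · simp_rw [hGu, lintegral_one, ← hmass _ MeasurableSet.univ]
      have h := tendsto_measure_iUnion_atTop (μ := ν Set.univ)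
        (s := fun n : ℕ => Set.Iic (((n : ℚ) : ℝ)))
        (fun a b hab => Set.Iic_subset_Iic.2 (by exact_mod_cast hab))
      rwa [show (⋃ n : ℕ, Set.Iic (((n : ℚ) : ℝ))) = Set.univ from by
        ext x
        obtain ⟨n, hn⟩ := exists_nat_ge x
        simpa using ⟨n, hn⟩] at h
    · filter_upwards [hmono] with ω h a b hab using h (by exact_mod_cast hab)
    · filter_upwards [hle] with ω h n using h n
  -- A decreasing sequence above `F` whose integrals tend to that of `F` converges to `F` a.e. This
  -- serves the limit at `-∞` (`A = ∅`) and right continuity (`A = Iic q`).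
  have hanti : ∀ (u : ℕ → ℚ) (A : Set ℝ), Antitone u → (⋂ n, Set.Iic ((u n : ℝ))) = A →
      ∀ F : Ω → ENNReal, (∫⁻ ω, F ω ∂s = ν Set.univ A) → (∀ᵐ ω ∂s, ∀ n, F ω ≤ G (u n) ω) →
      ∀ᵐ ω ∂s, Tendsto (fun n => G (u n) ω) atTop (𝓝 (F ω)) := by
    intro u A hu hA F hF hFG
    refine tendsto_of_lintegral_tendsto_of_antitone (fun n => (hGm _).aemeasurable) ?_ ?_ hFG ?_
    · simp_rw [hGu, hF, ← hA]
      exact tendsto_measure_iInter_atTop (fun n => measurableSet_Iic.nullMeasurableSet)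
        (fun a b hab => Set.Iic_subset_Iic.2 (by exact_mod_cast hu hab)) ⟨0, measure_ne_top _ _⟩
    · filter_upwards [hmono] with ω h a b hab using h (hu hab)
    · rw [hGu]
      exact measure_ne_top _ _
  have hbot : ∀ᵐ ω ∂s, Tendsto (fun n : ℕ => G (-(n : ℚ)) ω) atTop (𝓝 0) := by
    refine hanti (fun n => -(n : ℚ)) ∅ (fun a b hab => by simpa using hab) ?_ (fun _ => 0) (by simp)
      (.of_forall fun _ _ => zero_le)
    ext x
    obtain ⟨n, hn⟩ := exists_nat_gt (-x)
    simp only [Set.mem_iInter, Set.mem_Iic, Set.mem_empty_iff_false, iff_false, not_forall, not_le]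
    exact ⟨n, by push_cast; linarith⟩
  have hright : ∀ᵐ ω ∂s, ∀ q : ℚ,
      Tendsto (fun n : ℕ => G (q + 1 / ((n : ℚ) + 1)) ω) atTop (𝓝 (G q ω)) := by
    rw [ae_all_iff]
    intro q
    refine hanti (fun n => q + 1 / ((n : ℚ) + 1)) (Set.Iic (q : ℝ)) (fun a b hab => ?_) ?_ (G q)
      (hGu q) ?_
    · have : (a : ℚ) ≤ b := by exact_mod_cast hab
      show q + 1 / ((b : ℚ) + 1) ≤ q + 1 / ((a : ℚ) + 1)
      gcongr
    · ext x
      simp only [Set.mem_iInter, Set.mem_Iic]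
      refine ⟨fun h => le_of_forall_pos_le_add fun ε hε => ?_, fun h n => h.trans ?_⟩
      · obtain ⟨n, hn⟩ := exists_nat_one_div_lt hε
        refine (h n).trans ?_
        push_cast
        linarith
      · push_cast
        have : (0 : ℝ) < 1 / ((n : ℝ) + 1) := by positivity
        linarith
    · filter_upwards [hmono] with ω h n
      refine h ?_
      have : (0 : ℚ) < 1 / ((n : ℚ) + 1) := by positivity
      linarith
  let f : Ω → ℚ → ℝ := fun ω q => (G q ω).toReal
  have hf : Measurable f := measurable_pi_iff.2 fun q => (hGm q).ennreal_toReal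
  have hpt : ∀ᵐ ω ∂s, IsRatStieltjesPoint f ω := by
    filter_upwards [hmono, hle, htop, hbot, hright] with ω h1 h2 h3 h4 h5
    have hne : ∀ q, G q ω ≠ ⊤ := fun q => ((h2 q).trans_lt ENNReal.one_lt_top).ne
    have hm : Monotone (f ω) := fun a b hab => ENNReal.toReal_mono (hne b) (h1 hab)
    refine ⟨hm, ?_, ?_, fun t => ?_⟩
    · rw [tendsto_iff_tendsto_subseq_of_monotone hm tendsto_natCast_atTop_atTop]
      rw [← ENNReal.toReal_one]
      exact (ENNReal.tendsto_toReal ENNReal.one_ne_top).comp h3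
    · refine tendsto_comp_neg_atTop_iff.mp ?_
      have ha : Antitone fun q => f ω (-q) := hm.comp_antitone monotone_id.neg
      refine (tendsto_iff_tendsto_subseq_of_antitone ha
        (tendsto_natCast_atTop_atTop (R := ℚ))).mpr ?_
      rw [← ENNReal.toReal_zero]
      exact (ENNReal.tendsto_toReal ENNReal.zero_ne_top).comp h4
    · have hb : BddBelow (Set.range fun r : Set.Ioi t => f ω r) :=
        ⟨0, by rintro _ ⟨r, rfl⟩; exact ENNReal.toReal_nonneg⟩
      -- The sequence `t + 1/(n+1)` already bounds the infimum over all larger rationals by `f ω t`.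
      refine le_antisymm ?_ (le_ciInf fun r => hm (le_of_lt r.2))
      refine ge_of_tendsto' ((ENNReal.tendsto_toReal (hne t)).comp (h5 t)) fun n => ?_
      exact ciInf_le hb ⟨t + 1 / ((n : ℚ) + 1), by
        have : (0 : ℚ) < 1 / ((n : ℚ) + 1) := by positivity
        simpa using this⟩
  -- On the null set where `f ω` is not a rational distribution function a default one is
  -- substituted, so `κ` is Markov at every point.
  let κ : Kernel Ω ℝ := ⟨fun ω => (stieltjesOfMeasurableRat f hf ω).measure,
    measurable_measure_stieltjesOfMeasurableRat hf⟩
  have hκm : IsMarkovKernel κ := ⟨fun ω => ⟨measure_stieltjesOfMeasurableRat_univ hf ω⟩⟩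
  have hκ : ∀ᵐ ω ∂s, ∀ q : ℚ, κ ω (Set.Iic (q : ℝ)) = G q ω := by
    filter_upwards [hpt, hle] with ω h1 h2 q
    change (stieltjesOfMeasurableRat f hf ω).measure _ = _
    rw [measure_stieltjesOfMeasurableRat_Iic, stieltjesOfMeasurableRat_eq,
      toRatCDF_of_isRatStieltjesPoint h1, ENNReal.ofReal_toReal]
    exact ((h2 q).trans_lt ENNReal.one_lt_top).ne
  refine ⟨κ, hκm, fun C hC => ?_⟩
  have := hfin C hC
  refine ext_of_generate_finite _
    (by rw [← Real.borel_eq_generateFrom_Iic_rat]; exact BorelSpace.measurable_eq)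
    Real.isPiSystem_Iic_rat ?_ ?_
  · intro A hA
    obtain ⟨q, rfl⟩ := Set.mem_iUnion.1 hA
    rw [Measure.bind_apply measurableSet_Iic κ.measurable.aemeasurable, ← hG q C hC]
    exact lintegral_congr_ae (ae_restrict_of_ae (hκ.mono fun ω h => (h q).symm))
  · rw [Measure.bind_apply MeasurableSet.univ κ.measurable.aemeasurable, hmass C hC]
    simp

/-- A Markov kernel into a countably generated space is determined almost everywhere by its
averages over measurable sets. -/
theorem kernel_ae_eq_of_forall_bind_restrict {Ω X : Type*} [MeasurableSpace Ω] [MeasurableSpace X]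
    [MeasurableSpace.CountablyGenerated X] {s : Measure Ω} [IsFiniteMeasure s] {κ η : Kernel Ω X}
    [IsMarkovKernel κ] [IsMarkovKernel η]
    (h : ∀ C, MeasurableSet C → (s.restrict C).bind κ = (s.restrict C).bind η) :
    κ =ᵐ[s] η := by
  -- The averages over `C` are the values of the composition-product on rectangles, which determine
  -- it.
  refine Kernel.ae_eq_of_compProd_eq (Measure.ext_prod fun {C A} hC hA => ?_)
  rw [Measure.compProd_apply_prod hC hA, Measure.compProd_apply_prod hC hA]
  have := congrArg (fun m : Measure X => m A) (h C hC)
  simpa only [Measure.bind_apply hA κ.measurable.aemeasurable,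
    Measure.bind_apply hA η.measurable.aemeasurable] using this

end Disintegration

/-! ### Classical states: σ-convexity and linear hull. -/

section States

variable {Ω : Type*} [MeasurableSpace Ω]

/-- A probability measure as a classical state. -/
noncomputable def toState (μ : Measure Ω) [h : IsProbabilityMeasure μ] : classicalStates Ω :=
  ⟨μ.toSignedMeasure, ⟨μ, h⟩, rfl⟩

theorem stateMeasure_toState (μ : Measure Ω) [IsProbabilityMeasure μ] :
    (stateMeasure (toState μ) : Measure Ω) = μ :=
  Measure.toSignedMeasure_eq_toSignedMeasure_iff.1 (stateMeasure_toSignedMeasure (toState μ))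

theorem toState_stateMeasure (s : classicalStates Ω) :
    toState (stateMeasure s : Measure Ω) = s :=
  Subtype.ext (stateMeasure_toSignedMeasure s)

theorem norm_toSignedMeasure_eq_one (P : ProbabilityMeasure Ω) :
    ‖(P : Measure Ω).toSignedMeasure‖ = 1 := by
  rw [signedMeasure_norm_def, SignedMeasure.totalVariation_eq_variation,
    Measure.variation_toSignedMeasure]
  simp

theorem hasSum_weights_of_eq_sum {w : ℕ → ℝ} (h0 : ∀ i, 0 ≤ w i) {P : ℕ → ProbabilityMeasure Ω}
    {Q : ProbabilityMeasure Ω}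
    (h : (Q : Measure Ω) = Measure.sum fun i => ENNReal.ofReal (w i) • (P i : Measure Ω)) :
    HasSum w 1 := by
  have h1 := congrArg (fun m : Measure Ω => m Set.univ) h
  simp only [measure_univ, Measure.sum_apply _ MeasurableSet.univ, Measure.smul_apply, smul_eq_mul,
    mul_one] at h1
  have h2 := ENNReal.hasSum_toReal (f := fun i => ENNReal.ofReal (w i)) (by simp [← h1])
  rw [← ENNReal.tsum_toReal_eq (fun i => ENNReal.ofReal_ne_top), ← h1] at h2
  simpa [ENNReal.toReal_ofReal (h0 _)] using h2

/-- A countable mixture of probability measures converges in the total variation norm. -/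
theorem hasSum_toSignedMeasure {w : ℕ → ℝ} (h0 : ∀ i, 0 ≤ w i) {P : ℕ → ProbabilityMeasure Ω}
    {Q : ProbabilityMeasure Ω}
    (h : (Q : Measure Ω) = Measure.sum fun i => ENNReal.ofReal (w i) • (P i : Measure Ω)) :
    HasSum (fun i => w i • (P i : Measure Ω).toSignedMeasure) (Q : Measure Ω).toSignedMeasure := by
  have hw := hasSum_weights_of_eq_sum h0 h
  have hs : Summable fun i => w i • (P i : Measure Ω).toSignedMeasure := by
    -- States have norm one, so the series converges absolutely; its limit is then identified set by
    -- set.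
    refine Summable.of_norm ?_
    simpa only [norm_smul, norm_toSignedMeasure_eq_one, mul_one] using hw.summable.norm
  obtain ⟨v, hv⟩ := hs
  convert hv
  ext A hA
  have h1 := signedMeasure_hasSum_apply hv A
  refine HasSum.unique ?_ h1
  rw [Measure.toSignedMeasure_apply_measurable hA]
  change HasSum (fun i => w i * (P i : Measure Ω).toSignedMeasure A) _
  simp only [Measure.toSignedMeasure_apply_measurable hA]
  have h2 := congrArg (fun m : Measure Ω => m A) h
  simp only [Measure.sum_apply _ hA, Measure.smul_apply, smul_eq_mul] at h2
  have h3 := ENNReal.hasSum_toReal (h2 ▸ measure_ne_top (Q : Measure Ω) A)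
  rw [← ENNReal.tsum_toReal_eq
    (fun i => ENNReal.mul_ne_top ENNReal.ofReal_ne_top (measure_ne_top _ _)), ← h2] at h3
  simpa [ENNReal.toReal_mul, ENNReal.toReal_ofReal (h0 _), Measure.real] using h3

theorem isProbabilisticTheory_classicalStates : IsProbabilisticTheory (classicalStates Ω) where
  sigmaConvex w v h0 h1 hv := by
    let P : ℕ → ProbabilityMeasure Ω := fun i => stateMeasure ⟨v i, hv i⟩
    let Q : ProbabilityMeasure Ω :=
      ⟨Measure.sum fun i => ENNReal.ofReal (w i) • (P i : Measure Ω), ⟨by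
        rw [Measure.sum_apply _ MeasurableSet.univ]
        simp only [Measure.smul_apply, measure_univ, smul_eq_mul, mul_one]
        rw [← ENNReal.ofReal_tsum_of_nonneg h0 h1.summable, h1.tsum_eq, ENNReal.ofReal_one]⟩⟩
    refine ⟨(Q : Measure Ω).toSignedMeasure, ⟨Q, rfl⟩, ?_⟩
    have h := hasSum_toSignedMeasure h0 (P := P) (Q := Q) rfl
    simp only [P, stateMeasure_toSignedMeasure] at h
    exact h

/-- A nonzero finite measure is a multiple of a state. -/
theorem exists_eq_smul_stateMeasure (μ : Measure Ω) [IsFiniteMeasure μ] (hμ : μ ≠ 0) :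
    ∃ v : classicalStates Ω, μ = μ Set.univ • (stateMeasure v : Measure Ω) := by
  have h0 : μ Set.univ ≠ 0 := by simpa using hμ
  have h1 : μ Set.univ ≠ ⊤ := measure_ne_top _ _
  have : IsProbabilityMeasure ((μ Set.univ)⁻¹ • μ) := ⟨by simp [ENNReal.inv_mul_cancel h0 h1]⟩
  refine ⟨toState ((μ Set.univ)⁻¹ • μ), ?_⟩
  rw [stateMeasure_toState, smul_smul, ENNReal.mul_inv_cancel h0 h1,
    one_smul]

theorem toSignedMeasure_mem_span (μ : Measure Ω) [IsFiniteMeasure μ] :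
    μ.toSignedMeasure ∈ Submodule.span ℝ (classicalStates Ω) := by
  by_cases hμ : μ = 0
  · subst hμ
    simp
  obtain ⟨v, hv⟩ := exists_eq_smul_stateMeasure μ hμ
  have : μ.toSignedMeasure = μ.real Set.univ • (v : SignedMeasure Ω) := by
    ext A hA
    rw [← stateMeasure_toSignedMeasure v, smul_apply,
      Measure.toSignedMeasure_apply_measurable hA, Measure.toSignedMeasure_apply_measurable hA]
    conv_lhs => rw [hv]
    simp [Measure.real]
  rw [this]
  exact Submodule.smul_mem _ _ (Submodule.subset_span v.2)

/-- By the Jordan decomposition the span is already everything, before taking the closure. -/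
theorem generates_classicalStates : Generates (classicalStates Ω) := by
  have h : Submodule.span ℝ (classicalStates Ω) = ⊤ := by
    refine Submodule.eq_top_iff'.2 fun v => ?_
    rw [← v.toSignedMeasure_toJordanDecomposition]
    exact Submodule.sub_mem _ (toSignedMeasure_mem_span _) (toSignedMeasure_mem_span _)
  rw [Generates, h]
  exact top_le_iff.1 (Submodule.le_topologicalClosure _)

end States

/-! ### Extension of observables to finite measures, and local kernels. -/

section Extension

open ProbabilityTheory

variable {Ω : Type*} [MeasurableSpace Ω]

/-- Turns σ-affinity into a statement about measures only: a setwise mixture of states automatically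
converges in total variation. -/
theorem Observable.toFun_eq_sum {X : Type*} [MeasurableSpace X]
    (M : Observable (classicalStates Ω) X) {w : ℕ → ℝ} (h0 : ∀ i, 0 ≤ w i)
    {v : ℕ → classicalStates Ω} {s : classicalStates Ω}
    (h : (stateMeasure s : Measure Ω) =
      Measure.sum fun i => ENNReal.ofReal (w i) • (stateMeasure (v i) : Measure Ω)) :
    (M.toFun s : Measure X) =
      Measure.sum fun i => ENNReal.ofReal (w i) • (M.toFun (v i) : Measure X) := by
  ext A hA
  have h1 := hasSum_toSignedMeasure h0 h
  simp only [stateMeasure_toSignedMeasure] at h1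
  have h2 := M.sigmaAffine w v s h0 (hasSum_weights_of_eq_sum h0 h) h1 A hA
  rw [Measure.sum_apply _ hA, ← ENNReal.ofReal_toReal (measure_ne_top (M.toFun s : Measure X) A)]
  change ENNReal.ofReal ((M.toFun s : Measure X).real A) = _
  rw [← h2.tsum_eq, ENNReal.ofReal_tsum_of_nonneg
    (fun i => mul_nonneg (h0 i) measureReal_nonneg) h2.summable]
  congr 1
  ext i
  rw [ENNReal.ofReal_mul (h0 i)]
  simp [Measure.real]

open Classical in
/-- The positively homogeneous extension of an observable to finite measures. -/
noncomputable def Observable.extend (M : Observable (classicalStates Ω) ℝ) (μ : Measure Ω) :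
    Measure ℝ :=
  -- The condition fails exactly for total mass 0 or `∞`; the default 0 is the right value at `μ =
  -- 0`.
  if h : IsProbabilityMeasure ((μ Set.univ)⁻¹ • μ) then
    μ Set.univ • (M.toFun (toState _ (h := h)) : Measure ℝ) else 0

variable (M : Observable (classicalStates Ω) ℝ)

theorem Observable.extend_zero : M.extend 0 = 0 := by
  rw [Observable.extend]
  split_ifs <;> simp

theorem Observable.extend_smul_stateMeasure (v : classicalStates Ω) {c : ENNReal} (hc : c ≠ ⊤) :
    M.extend (c • (stateMeasure v : Measure Ω)) = c • (M.toFun v : Measure ℝ) := by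
  by_cases h0 : c = 0
  · simp [h0, M.extend_zero]
  have h1 : ((c • (stateMeasure v : Measure Ω)) Set.univ)⁻¹ • (c • (stateMeasure v : Measure Ω)) =
      stateMeasure v := by
    simp [smul_smul, ENNReal.inv_mul_cancel h0 hc]
  have h2 : IsProbabilityMeasure (((c • (stateMeasure v : Measure Ω)) Set.univ)⁻¹ •
      (c • (stateMeasure v : Measure Ω))) := by
    rw [h1]
    infer_instance
  have h3 : toState _ (h := h2) = v := by
    conv_rhs => rw [← toState_stateMeasure v]
    congr 1
  rw [Observable.extend, dif_pos h2, h3]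
  simp

theorem Observable.extend_stateMeasure (v : classicalStates Ω) :
    M.extend (stateMeasure v) = M.toFun v := by
  simpa using M.extend_smul_stateMeasure v ENNReal.one_ne_top

theorem Observable.extend_univ (μ : Measure Ω) [IsFiniteMeasure μ] :
    M.extend μ Set.univ = μ Set.univ := by
  by_cases hμ : μ = 0
  · simp [hμ, M.extend_zero]
  obtain ⟨v, hv⟩ := exists_eq_smul_stateMeasure μ hμ
  conv_lhs => rw [hv, M.extend_smul_stateMeasure v (measure_ne_top _ _)]
  simp

theorem Observable.extend_smul (μ : Measure Ω) [IsFiniteMeasure μ] {c : ENNReal} (hc : c ≠ ⊤) :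
    M.extend (c • μ) = c • M.extend μ := by
  by_cases hμ : μ = 0
  · simp [hμ, M.extend_zero]
  obtain ⟨v, hv⟩ := exists_eq_smul_stateMeasure μ hμ
  have hm := measure_ne_top μ Set.univ
  generalize μ Set.univ = m at hv hm
  rw [hv, smul_smul, M.extend_smul_stateMeasure v (ENNReal.mul_ne_top hc hm),
    M.extend_smul_stateMeasure v hm, smul_smul]

theorem measure_smul_sum {X : Type*} [MeasurableSpace X] (c : ENNReal) (μ : ℕ → Measure X) :
    c • Measure.sum μ = Measure.sum fun i => c • μ i := by
  ext A hA
  simp [Measure.sum_apply _ hA, ENNReal.tsum_mul_left]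

/-- Division by the total mass `c` makes the sum a σ-convex combination of states with weights `m i
/ c`, to which σ-affinity applies. -/
theorem Observable.extend_sum (μ : ℕ → Measure Ω) [IsFiniteMeasure (Measure.sum μ)] :
    M.extend (Measure.sum μ) = Measure.sum fun i => M.extend (μ i) := by
  have hfin : ∀ i, IsFiniteMeasure (μ i) := fun i =>
    isFiniteMeasure_of_le _ (Measure.le_sum μ i)
  by_cases hμ : Measure.sum μ = 0
  · have h : ∀ i, μ i = 0 := fun i =>
      le_antisymm (hμ ▸ Measure.le_sum μ i) (Measure.zero_le _)
    rw [hμ, M.extend_zero]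
    simp [h, M.extend_zero]
  obtain ⟨s, hs⟩ := exists_eq_smul_stateMeasure (Measure.sum μ) hμ
  have hc0 : Measure.sum μ Set.univ ≠ 0 := by simpa using hμ
  have hc := measure_ne_top (Measure.sum μ) Set.univ
  generalize Measure.sum μ Set.univ = c at hs hc0 hc
  have hv : ∀ i, ∃ v : classicalStates Ω, μ i = μ i Set.univ • (stateMeasure v : Measure Ω) :=
    fun i => by
      by_cases h : μ i = 0
      -- A zero summand has weight zero, so any state may stand in for it.
      · exact ⟨s, by simp [h]⟩
      · exact exists_eq_smul_stateMeasure _ h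
  choose v hv using hv
  have hm : ∀ i, μ i Set.univ ≠ ⊤ := fun i => measure_ne_top _ _
  generalize hmdef : (fun i => μ i Set.univ) = m at *
  have hmi : ∀ i, μ i Set.univ = m i := fun i => congrFun hmdef i
  simp only [hmi] at hv hm
  have hw : ∀ i, ENNReal.ofReal (c⁻¹ * m i).toReal = c⁻¹ * m i := fun i =>
    ENNReal.ofReal_toReal (ENNReal.mul_ne_top (ENNReal.inv_ne_top.2 hc0) (hm i))
  have hmix : (stateMeasure s : Measure Ω) = Measure.sum fun i =>
      ENNReal.ofReal (c⁻¹ * m i).toReal • (stateMeasure (v i) : Measure Ω) := by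
    simp only [hw, mul_smul, ← hv]
    rw [← measure_smul_sum, hs, smul_smul, ENNReal.inv_mul_cancel hc0 hc, one_smul]
  have h := M.toFun_eq_sum (fun i => ENNReal.toReal_nonneg) hmix
  rw [hs, M.extend_smul_stateMeasure s hc, h, measure_smul_sum]
  congr 1
  ext1 i
  rw [hw, smul_smul, ← mul_assoc, ENNReal.mul_inv_cancel hc0 hc, one_mul, hv i,
    M.extend_smul_stateMeasure _ (hm i)]

theorem sum_eq_add_of_eq_zero {X : Type*} [MeasurableSpace X] (μ : ℕ → Measure X)
    (h : ∀ i, μ (i + 2) = 0) : Measure.sum μ = μ 0 + μ 1 := by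
  ext A hA
  rw [Measure.sum_apply _ hA, tsum_eq_sum (s := Finset.range 2)]
  · simp [Finset.sum_range_succ]
  · intro i hi
    obtain ⟨j, rfl⟩ := Nat.exists_eq_add_of_le' (by simpa using hi : 1 < i)
    simp [h]

theorem Observable.extend_add (μ ν : Measure Ω) [IsFiniteMeasure μ] [IsFiniteMeasure ν] :
    M.extend (μ + ν) = M.extend μ + M.extend ν := by
  let u : ℕ → Measure Ω := fun i => if i = 0 then μ else if i = 1 then ν else 0
  have hu : Measure.sum u = μ + ν := by
    rw [sum_eq_add_of_eq_zero u (by simp [u])]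
    simp [u]
  have : IsFiniteMeasure (Measure.sum u) := by
    rw [hu]
    infer_instance
  rw [← hu, M.extend_sum u, sum_eq_add_of_eq_zero _ (by simp [u, M.extend_zero])]
  simp [u]

/-- If a kernel represents an observable on the restrictions of a finite measure `μ`, then it does
so on all finite measures which are absolutely continuous with respect to `μ`. -/
theorem Observable.extend_eq_bind {μ : Measure Ω} [IsFiniteMeasure μ] {κ : Kernel Ω ℝ}
    (hκ : ∀ C, MeasurableSet C → M.extend (μ.restrict C) = (μ.restrict C).bind κ)
    {ρ : Measure Ω} [IsFiniteMeasure ρ] (hρ : ρ ≪ μ) : M.extend ρ = ρ.bind κ := by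
  have hadd : ∀ a b : Measure Ω, (a + b).bind κ = a.bind κ + b.bind κ := fun a b => by
    ext A hA
    simp [Measure.bind_apply hA κ.measurable.aemeasurable]
  -- Densities are built up from multiples of indicators. Finiteness is carried through the
  -- induction because `extend_add` requires it.
  have hsimple : ∀ g : SimpleFunc Ω NNReal, IsFiniteMeasure (μ.withDensity fun ω => (g ω : ENNReal)) ∧
      M.extend (μ.withDensity fun ω => (g ω : ENNReal)) =
        (μ.withDensity fun ω => (g ω : ENNReal)).bind κ := by
    intro g
    induction g using SimpleFunc.induction with
    | const c hs =>
      rename_i C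
      have h : (μ.withDensity fun ω => ((SimpleFunc.piecewise C hs (SimpleFunc.const _ c)
          (SimpleFunc.const _ 0) ω : NNReal) : ENNReal)) = (c : ENNReal) • μ.restrict C := by
        rw [← withDensity_const, ← withDensity_indicator hs]
        congr 1
        ext ω
        by_cases hω : ω ∈ C <;> simp [hω]
      rw [h, M.extend_smul _ ENNReal.coe_ne_top, hκ C hs, Measure.bind_smul]
      exact ⟨Measure.smul_finite _ ENNReal.coe_ne_top, rfl⟩
    | @add f g _ hf hg =>
      obtain ⟨hf1, hf2⟩ := hf
      obtain ⟨hg1, hg2⟩ := hg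
      have h : (μ.withDensity fun ω => (((f + g) ω : NNReal) : ENNReal)) =
          (μ.withDensity fun ω => (f ω : ENNReal)) + μ.withDensity fun ω => (g ω : ENNReal) := by
        rw [← withDensity_add_left f.measurable.coe_nnreal_ennreal]
        congr 1
      rw [h, M.extend_add, hadd, hf2, hg2]
      exact ⟨inferInstance, rfl⟩
  -- Writing the density as a countable sum of simple functions lets `extend_sum` replace a monotone
  -- limit.
  have hρs : ρ = Measure.sum fun n => μ.withDensity fun ω =>
      (SimpleFunc.eapproxDiff (ρ.rnDeriv μ) n ω : ENNReal) := by
    rw [← withDensity_tsum fun n =>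
      (SimpleFunc.eapproxDiff (ρ.rnDeriv μ) n).measurable.coe_nnreal_ennreal]
    conv_lhs => rw [← Measure.withDensity_rnDeriv_eq _ _ hρ]
    congr 1
    ext ω
    rw [ENNReal.tsum_apply, SimpleFunc.tsum_eapproxDiff _ (Measure.measurable_rnDeriv _ _)]
  have : IsFiniteMeasure (Measure.sum fun n => μ.withDensity fun ω =>
      (SimpleFunc.eapproxDiff (ρ.rnDeriv μ) n ω : ENNReal)) := hρs ▸ ‹IsFiniteMeasure ρ›
  rw [hρs, M.extend_sum, Measure.bind_sum _ _ κ.measurable.aemeasurable]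
  simp only [(hsimple _).2]

/-- σ-additivity of the extension makes `C ↦ M.extend (s|_C)` disintegrate over `s`; approximation
of densities then reaches every `ρ ≪ s`. -/
theorem Observable.exists_kernel (s : classicalStates Ω) :
    ∃ κ : Kernel Ω ℝ, IsMarkovKernel κ ∧ ∀ ρ : Measure Ω, IsFiniteMeasure ρ →
      ρ ≪ (stateMeasure s : Measure Ω) → M.extend ρ = ρ.bind κ := by
  obtain ⟨κ, hκ, h⟩ := exists_kernel_of_sigmaAdditive (stateMeasure s : Measure Ω)
    (fun C => M.extend ((stateMeasure s : Measure Ω).restrict C))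
    (fun C hC => by simp [M.extend_univ])
    (fun C hC hd => by
      simp only [Measure.restrict_iUnion hd hC]
      have : IsFiniteMeasure (Measure.sum fun i => (stateMeasure s : Measure Ω).restrict (C i)) := by
        rw [← Measure.restrict_iUnion hd hC]
        infer_instance
      exact M.extend_sum _)
  exact ⟨κ, hκ, fun ρ _ hρ => M.extend_eq_bind h hρ⟩

/-- A Markov kernel which represents an observable on the measures that are absolutely continuous
with respect to the state `s`. -/
noncomputable def Observable.localKernel (s : classicalStates Ω) : Kernel Ω ℝ :=
  Classical.choose (M.exists_kernel s)

instance Observable.isMarkovKernel_localKernel (s : classicalStates Ω) :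
    IsMarkovKernel (M.localKernel s) :=
  (Classical.choose_spec (M.exists_kernel s)).1

theorem Observable.extend_eq_bind_localKernel (s : classicalStates Ω) (ρ : Measure Ω)
    [hρ : IsFiniteMeasure ρ] (h : ρ ≪ (stateMeasure s : Measure Ω)) : M.extend ρ = ρ.bind (M.localKernel s) :=
  (Classical.choose_spec (M.exists_kernel s)).2 ρ hρ h

theorem Observable.bind_localKernel (s : classicalStates Ω) :
    (stateMeasure s : Measure Ω).bind (M.localKernel s) = M.toFun s := by
  rw [← M.extend_eq_bind_localKernel s _ Measure.AbsolutelyContinuous.rfl, M.extend_stateMeasure]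

/-- Both kernels represent `M` on the restrictions of `t`, since these are `≪ t ≪ s`. This
consistency is what makes the joint observable σ-affine. -/
theorem Observable.localKernel_ae_eq {s t : classicalStates Ω}
    (h : (stateMeasure t : Measure Ω) ≪ (stateMeasure s : Measure Ω)) :
    M.localKernel t =ᵐ[(stateMeasure t : Measure Ω)] M.localKernel s :=
  kernel_ae_eq_of_forall_bind_restrict fun C _ => by
    have hC := (Measure.restrict_le_self (μ := (stateMeasure t : Measure Ω))
      (s := C)).absolutelyContinuous
    exact (M.extend_eq_bind_localKernel t _ hC).symm.trans
      (M.extend_eq_bind_localKernel s _ (hC.trans h))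

end Extension

/-! ### Joint observables from products of kernels. -/

section Joint

open ProbabilityTheory

variable {Ω : Type*} [MeasurableSpace Ω]

/-- The product of two kernels to the line, as a kernel to the plane `Fin 2 → ℝ`. -/
noncomputable def planeKernel (κ η : Kernel Ω ℝ) : Kernel Ω (Fin 2 → ℝ) :=
  (κ ×ₖ η).map (MeasurableEquiv.finTwoArrow (α := ℝ)).symm

instance isMarkovKernel_planeKernel (κ η : Kernel Ω ℝ) [IsMarkovKernel κ] [IsMarkovKernel η] :
    IsMarkovKernel (planeKernel κ η) :=
  Kernel.IsMarkovKernel.map _ (MeasurableEquiv.measurable _)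

theorem measurableSet_rectangle {A B : Set ℝ} (hA : MeasurableSet A) (hB : MeasurableSet B) :
    MeasurableSet {x : Fin 2 → ℝ | x 0 ∈ A ∧ x 1 ∈ B} :=
  (measurable_pi_apply 0 hA).inter (measurable_pi_apply 1 hB)

theorem planeKernel_rectangle (κ η : Kernel Ω ℝ) [IsMarkovKernel κ] [IsMarkovKernel η] (ω : Ω)
    {A B : Set ℝ} (hA : MeasurableSet A) (hB : MeasurableSet B) :
    planeKernel κ η ω {x | x 0 ∈ A ∧ x 1 ∈ B} = κ ω A * η ω B := by
  rw [planeKernel, Kernel.map_apply' _ (MeasurableEquiv.measurable _) _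
    (measurableSet_rectangle hA hB), ← Kernel.prod_apply_prod]
  rfl

/-- A joint observable for two observables only has to be tested on the two coordinates. -/
theorem isJointObservable_pair {J : Observable (classicalStates Ω) (Fin 2 → ℝ)}
    {M N : Observable (classicalStates Ω) ℝ}
    (h0 : ∀ (s : classicalStates Ω) (A : Set ℝ), MeasurableSet A →
      J.prob s {x | x 0 ∈ A ∧ x 1 ∈ Set.univ} = M.prob s A)
    (h1 : ∀ (s : classicalStates Ω) (A : Set ℝ), MeasurableSet A →
      J.prob s {x | x 0 ∈ Set.univ ∧ x 1 ∈ A} = N.prob s A) :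
    IsJointObservable J ![M, N] := by
  intro i s A hA
  fin_cases i
  · simpa using h0 s A hA
  · simpa using h1 s A hA

/-- The observable obtained by averaging a Markov kernel over the state. -/
noncomputable def kernelObservable {X : Type*} [MeasurableSpace X] (κ : Kernel Ω X)
    [IsMarkovKernel κ] : Observable (classicalStates Ω) X where
  toFun s := ⟨(stateMeasure s : Measure Ω).bind κ, inferInstance⟩
  sigmaAffine w v s h0 _ hs A hA := by
    simpa [Measure.real, Measure.bind_apply hA κ.measurable.aemeasurable] using
      hasSum_lintegral_state h0 hs (fun ω => κ ω A) (fun ω => prob_le_one)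

theorem kernelObservable_prob {X : Type*} [MeasurableSpace X] (κ : Kernel Ω X)
    [IsMarkovKernel κ] (s : classicalStates Ω) {A : Set X} (hA : MeasurableSet A) :
    (kernelObservable κ).prob s A = ∫ ω, (κ ω).real A ∂(stateMeasure s : Measure Ω) := by
  rw [integral_eq_lintegral_of_nonneg_ae (.of_forall fun ω => measureReal_nonneg)
    (κ.measurable_coe hA).ennreal_toReal.aestronglyMeasurable]
  simp [Observable.prob, kernelObservable, Measure.real,
    Measure.bind_apply hA κ.measurable.aemeasurable]

/-- Two observables on the plane with the same probabilities of rectangles are equal. -/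
theorem Observable.ext_of_rectangle {J J' : Observable (classicalStates Ω) (Fin 2 → ℝ)}
    (h : ∀ (s : classicalStates Ω) (A B : Set ℝ), MeasurableSet A → MeasurableSet B →
      J.prob s {x | x 0 ∈ A ∧ x 1 ∈ B} = J'.prob s {x | x 0 ∈ A ∧ x 1 ∈ B}) : J = J' := by
  have key : J.toFun = J'.toFun := by
    funext s
    apply ProbabilityMeasure.toMeasure_injective
    let e := MeasurableEquiv.finTwoArrow (α := ℝ)
    -- Transported to `ℝ × ℝ`, finite measures are determined by rectangles.
    refine e.map_measurableEquiv_injective (Measure.ext_prod fun {A B} hA hB => ?_)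
    rw [e.map_apply, e.map_apply, ← measureReal_eq_measureReal_iff]
    exact h s A B hA hB
  cases J
  cases J'
  simpa using key

/-- The value of an effect-valued measure at a point, as a measure. -/
noncomputable def EffectMeasure.measureAt (E : EffectMeasure Ω) (ω : Ω) : Measure ℝ :=
  Measure.ofMeasurable (fun A _ => ENNReal.ofReal (E.toFun A ω)) (by simp [E.empty])
    (fun A hA hd => by
      have h := E.iUnion A hA hd ω
      rw [← h.tsum_eq, ENNReal.ofReal_tsum_of_nonneg (fun i => (E.mem_Icc _ (hA i) ω).1)
        h.summable])

theorem EffectMeasure.measureAt_apply (E : EffectMeasure Ω) (ω : Ω) {A : Set ℝ}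
    (hA : MeasurableSet A) : E.measureAt ω A = ENNReal.ofReal (E.toFun A ω) :=
  Measure.ofMeasurable_apply A hA

/-- The kernel of an effect-valued measure. -/
noncomputable def EffectMeasure.kernel (E : EffectMeasure Ω) : Kernel Ω ℝ where
  toFun := E.measureAt
  measurable' := by
    refine Measure.measurable_of_measurable_coe _ fun A hA => ?_
    simp only [E.measureAt_apply _ hA]
    exact (E.measurable A hA).ennreal_ofReal

theorem EffectMeasure.kernel_apply (E : EffectMeasure Ω) (ω : Ω) {A : Set ℝ}
    (hA : MeasurableSet A) : E.kernel ω A = ENNReal.ofReal (E.toFun A ω) :=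
  E.measureAt_apply ω hA

instance EffectMeasure.isMarkovKernel_kernel (E : EffectMeasure Ω) : IsMarkovKernel E.kernel :=
  ⟨fun ω => ⟨by rw [E.kernel_apply ω MeasurableSet.univ, E.univ, ENNReal.ofReal_one]⟩⟩

/-- Given `ω`, the two outcomes are drawn independently from the two kernels; a marginal is the case
where the other set is the whole line. -/
theorem exists_joint_fuzzyObservable (E F : EffectMeasure Ω) :
    ∃ J : Observable (classicalStates Ω) (Fin 2 → ℝ),
      (∀ (s : classicalStates Ω) (A B : Set ℝ), MeasurableSet A → MeasurableSet B →
        J.prob s {x | x 0 ∈ A ∧ x 1 ∈ B} =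
          ∫ ω, E.toFun A ω * F.toFun B ω ∂(stateMeasure s : Measure Ω)) ∧
      IsJointObservable J ![fuzzyObservable E, fuzzyObservable F] := by
  have h : ∀ (s : classicalStates Ω) (A B : Set ℝ), MeasurableSet A → MeasurableSet B →
      (kernelObservable (planeKernel E.kernel F.kernel)).prob s {x | x 0 ∈ A ∧ x 1 ∈ B} =
        ∫ ω, E.toFun A ω * F.toFun B ω ∂(stateMeasure s : Measure Ω) := fun s A B hA hB => by
    rw [kernelObservable_prob _ _ (measurableSet_rectangle hA hB)]
    congr 1
    ext ω
    rw [Measure.real, planeKernel_rectangle _ _ _ hA hB, E.kernel_apply _ hA, F.kernel_apply _ hB,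
      ENNReal.toReal_mul, ENNReal.toReal_ofReal (E.mem_Icc A hA ω).1,
      ENNReal.toReal_ofReal (F.mem_Icc B hB ω).1]
  refine ⟨_, h, isJointObservable_pair (fun s A hA => ?_) (fun s A hA => ?_)⟩
  · rw [h s A _ hA MeasurableSet.univ, fuzzyObservable_prob _ _ hA]
    simp [F.univ]
  · rw [h s _ A MeasurableSet.univ hA, fuzzyObservable_prob _ _ hA]
    simp [E.univ]

/-- The fuzzy construction with deterministic kernels, whose product is the Dirac mass at `(f ω, g
ω)`. -/
theorem exists_joint_sharpObservable (f g : Ω → ℝ) (hf : Measurable f) (hg : Measurable g) :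
    ∃ J : Observable (classicalStates Ω) (Fin 2 → ℝ),
      (∀ (s : classicalStates Ω) (A B : Set ℝ), MeasurableSet A → MeasurableSet B →
        J.prob s {x | x 0 ∈ A ∧ x 1 ∈ B} =
          (stateMeasure s : Measure Ω).real (f ⁻¹' A ∩ g ⁻¹' B)) ∧
      (∀ J' : Observable (classicalStates Ω) (Fin 2 → ℝ),
        (∀ (s : classicalStates Ω) (A B : Set ℝ), MeasurableSet A → MeasurableSet B →
          J'.prob s {x | x 0 ∈ A ∧ x 1 ∈ B} =
            (stateMeasure s : Measure Ω).real (f ⁻¹' A ∩ g ⁻¹' B)) → J' = J) ∧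
      IsJointObservable J ![sharpObservable f hf, sharpObservable g hg] := by
  have h : ∀ (s : classicalStates Ω) (A B : Set ℝ), MeasurableSet A → MeasurableSet B →
      (kernelObservable (planeKernel (Kernel.deterministic f hf) (Kernel.deterministic g hg))).prob s
        {x | x 0 ∈ A ∧ x 1 ∈ B} = (stateMeasure s : Measure Ω).real (f ⁻¹' A ∩ g ⁻¹' B) :=
    fun s A B hA hB => by
      rw [kernelObservable_prob _ _ (measurableSet_rectangle hA hB),
        ← integral_indicator_one ((hf hA).inter (hg hB))]
      congr 1
      ext ω
      rw [Measure.real, planeKernel_rectangle _ _ _ hA hB, Kernel.deterministic_apply' hf ω hA,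
        Kernel.deterministic_apply' hg ω hB]
      by_cases h1 : f ω ∈ A <;> by_cases h2 : g ω ∈ B <;> simp [h1, h2]
  refine ⟨_, h, fun J' hJ' => Observable.ext_of_rectangle fun s A B hA hB => ?_,
    isJointObservable_pair (fun s A hA => ?_) (fun s A hA => ?_)⟩
  · rw [hJ' s A B hA hB, h s A B hA hB]
  · rw [h s A _ hA MeasurableSet.univ, sharpObservable_prob _ _ _ hA]
    simp
  · rw [h s _ A MeasurableSet.univ hA, sharpObservable_prob _ _ _ hA]
    simp

/-- The joint observable of two observables, whose probability of a rectangle in the state `s` is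
the integral of the product of the two local effects. -/
noncomputable def jointObservable (M N : Observable (classicalStates Ω) ℝ) :
    Observable (classicalStates Ω) (Fin 2 → ℝ) where
  toFun s := ⟨(stateMeasure s : Measure Ω).bind (planeKernel (M.localKernel s) (N.localKernel s)),
    inferInstance⟩
  sigmaAffine w v s h0 _ hs A hA := by
    -- The kernels of the mixture `s` are used for all components at once; what remains is to
    -- exchange them for those of `v i`.
    have h := hasSum_lintegral_state h0 hs
      (fun ω => planeKernel (M.localKernel s) (N.localKernel s) ω A) (fun ω => prob_le_one)
    simp only [Measure.real, ProbabilityMeasure.coe_mk,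
      Measure.bind_apply hA (Kernel.measurable _).aemeasurable]
    refine h.congr_fun fun i => ?_
    -- A component of weight zero need not be `≪ s`, but it contributes nothing.
    rcases (h0 i).eq_or_lt with hi | hi
    · simp [← hi]
    have hac : (stateMeasure (v i) : Measure Ω) ≪ (stateMeasure s : Measure Ω) := by
      rw [stateMeasure_eq_sum h0 hs]
      refine Measure.absolutelyContinuous_sum_right i (Measure.AbsolutelyContinuous.rfl.smul_right ?_)
      simpa using hi
    congr 2
    refine lintegral_congr_ae ?_
    filter_upwards [M.localKernel_ae_eq hac, N.localKernel_ae_eq hac] with ω h1 h2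
    simp only [planeKernel, Kernel.map_apply _ (MeasurableEquiv.measurable _), Kernel.prod_apply,
      h1, h2]

theorem jointObservable_rectangle (M N : Observable (classicalStates Ω) ℝ)
    (s : classicalStates Ω) {A B : Set ℝ} (hA : MeasurableSet A) (hB : MeasurableSet B) :
    ((jointObservable M N).toFun s : Measure (Fin 2 → ℝ)) {x | x 0 ∈ A ∧ x 1 ∈ B} =
      ∫⁻ ω, M.localKernel s ω A * N.localKernel s ω B ∂(stateMeasure s : Measure Ω) := by
  change (stateMeasure s : Measure Ω).bind _ _ = _
  rw [Measure.bind_apply (measurableSet_rectangle hA hB) (Kernel.measurable _).aemeasurable]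
  simp only [planeKernel_rectangle _ _ _ hA hB]

theorem isJointObservable_jointObservable (M N : Observable (classicalStates Ω) ℝ) :
    IsJointObservable (jointObservable M N) ![M, N] := by
  refine isJointObservable_pair (fun s A hA => ?_) (fun s A hA => ?_)
  · rw [Observable.prob, Observable.prob, ← M.bind_localKernel s, Measure.real, Measure.real,
      jointObservable_rectangle M N s hA MeasurableSet.univ,
      Measure.bind_apply hA (Kernel.measurable _).aemeasurable]
    simp
  · rw [Observable.prob, Observable.prob, ← N.bind_localKernel s, Measure.real, Measure.real,
      jointObservable_rectangle M N s MeasurableSet.univ hA,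
      Measure.bind_apply hA (Kernel.measurable _).aemeasurable]
    simp

theorem compatible_pair (M N : Observable (classicalStates Ω) ℝ) : Compatible ![M, N] :=
  ⟨_, isJointObservable_jointObservable M N⟩

end Joint

/-! ### Compatibility regions, intervals and the index. -/

section Index

variable {Ω : Type*} [MeasurableSpace Ω]

/-- Every weight works, since the mixture is itself an observable; the Dirac measure is an arbitrary
choice of noise. -/
theorem compatibilityInterval_eq (M N : Observable (classicalStates Ω) ℝ) :
    compatibilityInterval M N = Set.Icc (0 : ℝ) 1 := by
  ext c
  constructor
  · rintro ⟨l, rfl, -⟩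
    exact l.2
  · intro hc
    exact ⟨⟨c, hc⟩, rfl, ⟨Measure.dirac 0, inferInstance⟩, compatible_pair _ _⟩

theorem compatibilityRegion_eq (M : Fin 2 → Observable (classicalStates Ω) ℝ) :
    compatibilityRegion M = {c | ∀ i, c i ∈ Set.Icc (0 : ℝ) 1} := by
  ext c
  constructor
  · rintro ⟨l, hl, -⟩ i
    rw [hl i]
    exact (l i).2
  · intro hc
    refine ⟨fun i => ⟨c i, hc i⟩, fun _ => rfl, fun _ => ⟨Measure.dirac 0, inferInstance⟩, ?_⟩
    convert compatible_pair _ _ using 1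
    ext i
    fin_cases i <;> rfl

end Index

theorem mainTheorem5 (Ω : Type*) [MeasurableSpace Ω] :
    IsProbabilisticTheory (classicalStates Ω) ∧ Generates (classicalStates Ω) ∧
    (∀ (f g : Ω → ℝ) (hf : Measurable f) (hg : Measurable g),
      ∃ J : Observable (classicalStates Ω) (Fin 2 → ℝ),
        (∀ (s : classicalStates Ω) (A B : Set ℝ), MeasurableSet A → MeasurableSet B →
          J.prob s {x | x 0 ∈ A ∧ x 1 ∈ B} =
            (stateMeasure s : Measure Ω).real (f ⁻¹' A ∩ g ⁻¹' B)) ∧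
        (∀ J' : Observable (classicalStates Ω) (Fin 2 → ℝ),
          (∀ (s : classicalStates Ω) (A B : Set ℝ), MeasurableSet A → MeasurableSet B →
            J'.prob s {x | x 0 ∈ A ∧ x 1 ∈ B} =
              (stateMeasure s : Measure Ω).real (f ⁻¹' A ∩ g ⁻¹' B)) → J' = J) ∧
        IsJointObservable J ![sharpObservable f hf, sharpObservable g hg]) ∧
    (∀ E F : EffectMeasure Ω,
      ∃ J : Observable (classicalStates Ω) (Fin 2 → ℝ),
        (∀ (s : classicalStates Ω) (A B : Set ℝ), MeasurableSet A → MeasurableSet B →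
          J.prob s {x | x 0 ∈ A ∧ x 1 ∈ B} =
            ∫ ω, E.toFun A ω * F.toFun B ω ∂(stateMeasure s : Measure Ω)) ∧
        IsJointObservable J ![fuzzyObservable E, fuzzyObservable F]) ∧
    (∀ M N : Observable (classicalStates Ω) ℝ, Compatible ![M, N]) ∧
    compatibilityRegionOf 2 (classicalStates Ω) = {c | ∀ i, c i ∈ Set.Icc (0 : ℝ) 1} ∧
    compatibilityIntervalOf (classicalStates Ω) = Set.Icc (0 : ℝ) 1 ∧
    compatibilityIndexOf (classicalStates Ω) = 1 := by
  let T : Observable (classicalStates Ω) ℝ :=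
    trivialObservable _ ⟨Measure.dirac 0, inferInstance⟩
  refine ⟨isProbabilisticTheory_classicalStates, generates_classicalStates,
    exists_joint_sharpObservable, exists_joint_fuzzyObservable, compatible_pair, ?_, ?_, ?_⟩
  -- An intersection over an empty family would be the whole space; the trivial observable `T` rules
  -- this out.
  · have : Nonempty (Fin 2 → Observable (classicalStates Ω) ℝ) := ⟨fun _ => T⟩
    simp only [compatibilityRegionOf, compatibilityRegion_eq, Set.iInter_const]
  · have : Nonempty (Observable (classicalStates Ω) ℝ) := ⟨T⟩
    simp only [compatibilityIntervalOf, compatibilityInterval_eq, Set.iInter_const]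
  · have h : ∀ M N : Observable (classicalStates Ω) ℝ, compatibilityIndex M N = 1 := fun M N => by
      rw [compatibilityIndex, compatibilityInterval_eq, csSup_Icc zero_le_one]
    -- Here too `T` is needed: without any observable the set would be empty, not `{1}`.
    have hset : {r | ∃ M N : Observable (classicalStates Ω) ℝ, r = compatibilityIndex M N} =
        {(1 : ℝ)} := by
      ext r
      simp only [h, Set.mem_ofPred_eq, Set.mem_singleton_iff]
      exact ⟨fun ⟨_, _, hr⟩ => hr, fun hr => ⟨T, T, hr⟩⟩
    rw [compatibilityIndexOf, hset, csInf_singleton]
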